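/- A hypergraph $\mathcal{H}=(V,E)$ consists of a nonempty finite vertex set $V$ and a finite set $E$ of subsets of $V$, the edges; it is nonempty if $E\neq\varnothing$, and a singleton is an edge with exactly one vertex. The general Kneser graph $\operatorname{KG}(\mathcal{H})$ has vertex set $E$, two distinct edges of $\mathcal{H}$ being adjacent if and only if they are disjoint. A hypergraph is $2$-colorable if its vertices can be colored with two colors so that no edge is monochromatic (an empty edge counts as monochromatic), and the $2$-colorability defect of $\mathcal{H}$ is $$\operatorname{cd}_2(\mathcal{H})=\min\bigl\{|U| : U\subseteq V,\ \bigl(V\setminus U,\{e\in E: e\cap U=\varnothing\}\bigr)\text{ is }2\text{-colorable}\bigr\}$$ (with value $+\infty$ if there is no such $U$). For $t\ge 0$, let $K_{t,t}^*$ be the bipartite graph obtained from the complete bipartite graph $K_{t,t}$ by removing a perfect matching. Let $\mathcal{H}$ be a nonempty hypergraph with no singletons, and suppose that $$\chi(\operatorname{KG}(\mathcal{H}))=\operatorname{cd}_2(\mathcal{H})=t.$$ Then for every proper coloring of $\operatorname{KG}(\mathcal{H})$ with $t$ colors, $\operatorname{KG}(\mathcal{H})$ contains a (not necessarily induced) subgraph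 isomorphic to $K_{t,t}^*$ such that each of the $t$ colors appears on each of the two sides of this $K_{t,t}^*$. -/

import Mathlib

namespace Hypergraph

variable {α : Type*}

/-- The general Kneser graph `KG(H)`: its vertices are the edges of `H`, and two distinct vertices
are adjacent if the corresponding edges of `H` are disjoint. (Disjoint edges are automatically
distinct unless they are both empty.) -/
def kneserGraph (H : Hypergraph α) : SimpleGraph H.edgeSet where
  Adj e f := e ≠ f ∧ Disjoint (e : Set α) (f : Set α)
  symm := ⟨fun _ _ h => ⟨h.1.symm, h.2.symm⟩⟩
  loopless := ⟨fun _ h => h.1 rfl⟩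

/-- `H` is 2-colorable: its vertices can be colored with two colors in such a way that no edge is
monochromatic. (The values of `c` outside the vertex set are irrelevant, since every edge is
contained in the vertex set. An empty edge is monochromatic.) -/
def IsTwoColorable (H : Hypergraph α) : Prop :=
  ∃ c : α → Fin 2, ∀ e ∈ H.edgeSet, ¬ ∃ k : Fin 2, ∀ x ∈ e, c x = k

/-- The partial hypergraph that remains when the vertices in `U` are removed: its vertex set is
`V(H) \ U`, and its edges are the edges of `H` disjoint from `U`. -/
def removeVertices (H : Hypergraph α) (U : Set α) : Hypergraph α where
  vertexSet := H.vertexSet \ U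
  edgeSet := {e | e ∈ H.edgeSet ∧ e ∩ U = ∅}
  subset_vertexSet_of_mem_edgeSet' := fun e he x hx =>
    ⟨H.subset_vertexSet_of_mem_edgeSet he.1 hx, fun hU => by
      have hxU : x ∈ e ∩ U := ⟨hx, hU⟩
      rw [he.2] at hxU
      exact hxU⟩

/-- The 2-colorability defect `cd₂(H)`: the least number of vertices that have to be removed from
`H` so that the remaining partial hypergraph is 2-colorable. It is `⊤` if no removal of vertices
does this, which for finite `H` happens only if the empty set is an edge. -/
noncomputable def cd2 (H : Hypergraph α) : ℕ∞ :=
  ⨅ U ∈ {U : Set α | U ⊆ H.vertexSet ∧ (H.removeVertices U).IsTwoColorable}, U.encard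

end Hypergraph

/-- The graph `K*_{q,q}`: the complete bipartite graph `K_{q,q}` minus a perfect matching. -/
def completeBipartiteMinusMatching (q : ℕ) : SimpleGraph (Fin q ⊕ Fin q) :=
  (completeBipartiteGraph (Fin q) (Fin q)).deleteEdges
    (Set.range fun i : Fin q => s(Sum.inl i, Sum.inr i))

/-! ### Signed sets and signed flags -/

/-! Enumerate the vertices by `Fin n` and put m = n - t. Send a signed set X = (X⁺, X⁻) to the
signed set f X of those (k, b) for which X^b contains an edge of color k (`signedColors`). This f is
monotone and antipodal. Its values are consistent, because edges on opposite sides are disjoint and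
so differ in color. If f X = ∅, neither side contains an edge, and cd₂ = t forces |X| ≤ m
(`cd2_add_card_le`).

Where f X ≠ ∅, give X the sign of the largest element of f X. By Fan's lemma
(`odd_card_alternating`) the signs alternate along an odd number of full flags. On its top t levels
such a flag is forced onto one particular flag of `Fin t`, and its level m is sent to ∅. Grouping by
the first m levels, some group is odd: f has odd local degree above some Z with |Z| = m and f Z = ∅.
A door argument (`odd_card_flagsOver_flip`) shows that the parity is the same over every flag of
`Fin t`, so every {(k, b)} is the value of f at a one-element extension of Z.

Such an extension adds a vertex v_{k,b} and gives an edge E_{k,b} ⊆ Z^b ∪ {v_{k,b}} of color k. Here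
v_{k,+} = v_{k,-}, since otherwise two disjoint edges would share color k, and different colors have
different v. Hence E_{k,+} and E_{l,-} are disjoint for k ≠ l, which is a K*_{t,t}; the absence of
singletons gives E_{k,+} ≠ E_{k,-}. -/

namespace SignedSet

open Finset

/-- A full flag of signed subsets of `Fin n`: the position at which each element enters, together
with its sign. -/
abbrev Flag (n : ℕ) := Equiv.Perm (Fin n) × (Fin n → Bool)

variable {n : ℕ}

/-- The signed set formed by the first `j` elements of a flag. -/
def level (φ : Flag n) (j : ℕ) : Finset (Fin n × Bool) :=
  univ.filter fun x => (φ.1 x.1 : ℕ) < j ∧ φ.2 x.1 = x.2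

/-- The signed set with all signs reversed. -/
def neg (X : Finset (Fin n × Bool)) : Finset (Fin n × Bool) :=
  univ.filter fun x => (x.1, !x.2) ∈ X

/-- No element occurs with both signs. -/
def IsConsistent (X : Finset (Fin n × Bool)) : Prop :=
  ∀ x b b', (x, b) ∈ X → (x, b') ∈ X → b = b'

@[simp] lemma mem_level {φ : Flag n} {j : ℕ} {x : Fin n} {b : Bool} :
    (x, b) ∈ level φ j ↔ (φ.1 x : ℕ) < j ∧ φ.2 x = b := by
  simp [level]

@[simp] lemma mem_neg {X : Finset (Fin n × Bool)} {x : Fin n} {b : Bool} :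
    (x, b) ∈ neg X ↔ (x, !b) ∈ X := by
  simp [neg]

lemma level_isConsistent (φ : Flag n) (j : ℕ) : IsConsistent (level φ j) := by
  intro x b b' h h'
  rw [mem_level] at h h'
  exact h.2.symm.trans h'.2

lemma level_mono (φ : Flag n) {i j : ℕ} (h : i ≤ j) : level φ i ⊆ level φ j := by
  rintro ⟨x, b⟩ hx
  rw [mem_level] at hx ⊢
  exact ⟨hx.1.trans_le h, hx.2⟩

lemma level_zero (φ : Flag n) : level φ 0 = ∅ := by
  ext ⟨x, b⟩
  simp

lemma level_eq_image (φ : Flag n) (j : ℕ) :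
    level φ j = (univ.filter fun y : Fin n => (y : ℕ) < j).image
      fun y => (φ.1.symm y, φ.2 (φ.1.symm y)) := by
  ext ⟨x, b⟩
  simp only [mem_level, mem_image, mem_filter, mem_univ, true_and, Prod.mk.injEq]
  constructor
  · rintro ⟨h, rfl⟩
    exact ⟨φ.1 x, h, by simp, by simp⟩
  · rintro ⟨y, hy, rfl, rfl⟩
    simpa using hy

lemma card_level (φ : Flag n) {j : ℕ} (h : j ≤ n) : (level φ j).card = j := by
  rw [level_eq_image, card_image_of_injective]
  · rw [Fin.card_filter_val_lt, min_eq_right h]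
  · intro y z hyz
    simpa using congrArg Prod.fst hyz

lemma level_nonempty (φ : Flag n) {j : ℕ} (h0 : 0 < j) (h : j ≤ n) : (level φ j).Nonempty := by
  rw [← card_pos, card_level φ h]
  exact h0

lemma IsConsistent.card_le {X : Finset (Fin n × Bool)} (hX : IsConsistent X) : X.card ≤ n := by
  have h : (X.image Prod.fst).card = X.card := by
    apply card_image_of_injOn
    rintro ⟨x, b⟩ hx ⟨y, b'⟩ hy hxy
    obtain rfl : x = y := hxy
    rw [hX x b b' hx hy]
  rw [← h]
  simpa using card_le_univ (X.image Prod.fst)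

/-- Exchange the elements in positions `i` and `i + 1`. -/
def swapAt (i : ℕ) (φ : Flag n) : Flag n :=
  (if h : i + 1 < n then φ.1.trans (Equiv.swap ⟨i, i.lt_succ_self.trans h⟩ ⟨i + 1, h⟩) else φ.1,
    φ.2)

/-- Reverse the sign of the element in position `i`. -/
def signAt (i : ℕ) (φ : Flag n) : Flag n :=
  (φ.1, fun x => if (φ.1 x : ℕ) = i then !φ.2 x else φ.2 x)

/-- The flag that differs from `φ` in level `i + 1` only, within the elements of the first `d`
positions. -/
def flip (d i : ℕ) (φ : Flag n) : Flag n :=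
  if i + 1 < d then swapAt i φ else signAt i φ

lemma swapAt_val {i : ℕ} (h : i + 1 < n) (φ : Flag n) (x : Fin n) :
    (((swapAt i φ).1 x : Fin n) : ℕ) =
      if (φ.1 x : ℕ) = i then i + 1 else if (φ.1 x : ℕ) = i + 1 then i else φ.1 x := by
  simp only [swapAt, h, dite_true, Equiv.trans_apply, Equiv.swap_apply_def, Fin.ext_iff]
  split_ifs <;> rfl

lemma level_swapAt {i j : ℕ} (h : i + 1 < n) (hj : j ≠ i + 1) (φ : Flag n) :
    level (swapAt i φ) j = level φ j := by
  ext ⟨x, b⟩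
  rw [mem_level, mem_level, swapAt_val h]
  apply and_congr _ Iff.rfl
  split_ifs <;> omega

lemma level_signAt {i j : ℕ} (hj : j ≤ i) (φ : Flag n) :
    level (signAt i φ) j = level φ j := by
  ext ⟨x, b⟩
  rw [mem_level, mem_level]
  apply and_congr_right
  intro hx
  change (φ.1 x : ℕ) < j at hx
  simp [signAt, (hx.trans_le hj).ne]

/-- Levels are prefixes: swapping positions i and i + 1 affects only the prefix of length i + 1, and
a sign change in position i = d - 1 affects, among lengths up to d, only d itself. -/
lemma level_flip {d i j : ℕ} (hd : d ≤ n) (hi : i < d) (hj : j ≤ d) (hne : j ≠ i + 1)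
    (φ : Flag n) : level (flip d i φ) j = level φ j := by
  unfold flip
  split_ifs with h
  · exact level_swapAt (h.trans_le hd) hne φ
  · exact level_signAt (by omega) φ

lemma flip_flip {d : ℕ} (hd : d ≤ n) (i : ℕ) (φ : Flag n) : flip d i (flip d i φ) = φ := by
  unfold flip
  split_ifs with h
  · have h' := h.trans_le hd
    refine Prod.ext (Equiv.ext fun x => Fin.ext ?_) rfl
    rw [swapAt_val h', swapAt_val h']
    split_ifs <;> omega
  · refine Prod.ext rfl (funext fun x => ?_)
    by_cases hx : (φ.1 x : ℕ) = i <;> simp [signAt, hx]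

lemma flip_ne {d i : ℕ} (hd : d ≤ n) (hi : i < d) (φ : Flag n) : flip d i φ ≠ φ := by
  intro he
  have hin : i < n := hi.trans_le hd
  unfold flip at he
  split_ifs at he with h
  · have := swapAt_val (h.trans_le hd) φ (φ.1.symm ⟨i, hin⟩)
    rw [he] at this
    simp at this
  · have := congrFun (congrArg Prod.snd he) (φ.1.symm ⟨i, hin⟩)
    simp [signAt] at this

/-- A finite set on which some fixed-point-free involution acts has even cardinality. -/
lemma even_card_of_involution {β : Type*} (s : Finset β) (g : β → β) (hs : ∀ a ∈ s, g a ∈ s)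
    (hne : ∀ a ∈ s, g a ≠ a) (hg : ∀ a ∈ s, g (g a) = a) : Even s.card := by
  classical
  have h : ∑ _a ∈ s, (1 : ZMod 2) = 0 :=
    Finset.sum_involution (fun a _ => g a) (fun _ _ => by decide) (fun a ha _ => hne a ha)
      (fun a ha => hs a ha) (fun a ha => hg a ha)
  rw [Finset.sum_const, nsmul_one] at h
  exact (ZMod.natCast_eq_zero_iff_even).1 h

/-! ### The parity version of Fan's lemma -/

/-- The alternating sequence of signs. -/
def alt (i : ℕ) : Bool := i.bodd

@[simp] lemma alt_succ (i : ℕ) : alt (i + 1) = !alt i := by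
  simp [alt]

/-- Deleting one letter from a word of length `d + 1` so as to obtain the alternating word of length
`d` is possible in an odd number of ways only if the word alternates. -/
lemma odd_card_deletions_iff (d : ℕ) (w : ℕ → Bool) :
    Odd ((range (d + 1)).filter fun i =>
        (∀ k < i, w k = alt k) ∧ ∀ k < d, i ≤ k → w (k + 1) = alt k).card ↔
      (∀ k < d + 1, w k = alt k) ∨ (∀ k < d + 1, w k = !alt k) := by
  set s := (range (d + 1)).filter fun i =>
        (∀ k < i, w k = alt k) ∧ ∀ k < d, i ≤ k → w (k + 1) = alt k with hs
  -- Undoing the shift caused by the deletion: w follows `alt` before i and its complement after i,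
  -- with no condition at i.
  have mem : ∀ i, i ∈ s ↔ i < d + 1 ∧ (∀ k < i, w k = alt k) ∧
      ∀ k < d + 1, i < k → w k = !alt k := by
    intro i
    simp only [hs, mem_filter, mem_range]
    refine and_congr_right fun _ => and_congr_right fun _ => ⟨fun h k hk hik => ?_,
      fun h k hk hik => ?_⟩
    · obtain ⟨k, rfl⟩ : ∃ l, k = l + 1 := ⟨k - 1, by omega⟩
      rw [h k (by omega) (by omega), alt_succ, Bool.not_not]
    · rw [h (k + 1) (by omega) (by omega), alt_succ, Bool.not_not]
  have ne : ∀ k, w k = alt k → w k = !alt k → False := by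
    intro k h h'
    rw [h] at h'
    simp at h'
  have dich : ∀ k, w k ≠ alt k → w k = !alt k := by
    intro k h
    exact Bool.eq_not_of_ne h
  by_cases hpos : ∀ k < d + 1, w k = alt k
  · have : s = {d} := by
      ext i
      rw [mem, mem_singleton]
      constructor
      · rintro ⟨h1, -, h3⟩
        by_contra hid
        exact ne d (hpos d (by omega)) (h3 d (by omega) (by omega))
      · rintro rfl
        exact ⟨by omega, fun k hk => hpos k (by omega), fun k _ _ => by omega⟩
    simp only [this, card_singleton, odd_one, true_iff]
    exact Or.inl hpos
  by_cases hneg : ∀ k < d + 1, w k = !alt k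
  · have : s = {0} := by
      ext i
      rw [mem, mem_singleton]
      constructor
      · rintro ⟨h1, h2, -⟩
        by_contra hid
        exact ne 0 (h2 0 (by omega)) (hneg 0 (by omega))
      · rintro rfl
        exact ⟨by omega, fun k hk => by omega, fun k hk _ => hneg k hk⟩
    simp only [this, card_singleton, odd_one, true_iff]
    exact Or.inr hneg
  simp only [hpos, hneg, or_self, iff_false, Nat.not_odd_iff_even]
  -- If w switches once from `alt` to its complement, either letter at the switch can be deleted;
  -- otherwise none can.
  by_cases hcut : ∃ a < d, (∀ k < a + 1, w k = alt k) ∧ ∀ k < d + 1, a < k → w k = !alt k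
  · obtain ⟨a, had, ha1, ha2⟩ := hcut
    have : s = {a, a + 1} := by
      ext i
      rw [mem, mem_insert, mem_singleton]
      constructor
      · rintro ⟨h1, h2, h3⟩
        by_contra hid
        rcases lt_or_ge i a with h | h
        · exact ne a (ha1 a (by omega)) (h3 a (by omega) h)
        · exact ne (a + 1) (h2 (a + 1) (by omega)) (ha2 (a + 1) (by omega) (by omega))
      · rintro (rfl | rfl)
        · exact ⟨by omega, fun k hk => ha1 k (by omega), ha2⟩
        · exact ⟨by omega, ha1, fun k hk hk' => ha2 k hk (by omega)⟩
    rw [this, card_pair (by omega)]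
    exact even_two
  · have : s = ∅ := by
      rw [eq_empty_iff_forall_notMem]
      intro i hi
      rw [mem] at hi
      obtain ⟨h1, h2, h3⟩ := hi
      apply hcut
      by_cases hi : w i = alt i
      · refine ⟨i, ?_, fun k hk => ?_, h3⟩
        · by_contra hid
          refine hpos fun k hk => ?_
          rcases (show k < i ∨ k = i by omega) with h | rfl
          · exact h2 k h
          · exact hi
        · rcases (show k < i ∨ k = i by omega) with h | rfl
          · exact h2 k h
          · exact hi
      · have hi' := dich i hi
        have key : ∀ k < d + 1, i ≤ k → w k = !alt k := by
          intro k hk hik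
          rcases hik.lt_or_eq with h | rfl
          · exact h3 k hk h
          · exact hi'
        have : i ≠ 0 := by
          rintro rfl
          exact hneg fun k hk => key k hk (by omega)
        exact ⟨i - 1, by omega, fun k hk => h2 k (by omega), fun k hk hk' => key k hk (by omega)⟩
    simp [this]

/-- Double counting modulo two: the number of pairs `(a, i)` has the parity of the number of those
`a` that lie in an odd number of pairs. -/
lemma odd_card_sigma_iff {β ι : Type*} (s : Finset β) (u : Finset ι) (p : β → ι → Prop)
    [∀ a i, Decidable (p a i)] (q : β → Prop) [DecidablePred q]
    (h : ∀ a ∈ s, Odd (u.filter (p a)).card ↔ q a) :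
    Odd ((s ×ˢ u).filter fun x => p x.1 x.2).card ↔ Odd (s.filter q).card := by
  have h1 : ((s ×ˢ u).filter fun x => p x.1 x.2).card = ∑ a ∈ s, (u.filter (p a)).card := by
    rw [card_filter, sum_product]
    exact sum_congr rfl fun a _ => (card_filter _ _).symm
  rw [h1, odd_sum_iff_odd_card_odd, filter_congr h]

/-- The alternation condition on the first `d` levels of a flag. -/
def Alternates (sgn : Finset (Fin n × Bool) → Bool) (d : ℕ) (φ : Flag n) : Prop :=
  ∀ k < d, sgn (level φ (k + 1)) = alt k

open Classical in
/-- The flags that alternate on the subset of the first `d` elements of `Fin n`. -/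
noncomputable def alternatingFlags (sgn : Finset (Fin n × Bool) → Bool) (d : ℕ) : Finset (Flag n) :=
  univ.filter fun φ => (∀ x : Fin n, d ≤ x → φ.1 x = x ∧ φ.2 x = true) ∧ Alternates sgn d φ

lemma flip_fixes {d i : ℕ} {φ : Flag n}
    (h1 : ∀ x : Fin n, d + 1 ≤ x → φ.1 x = x) (x : Fin n) (hx : d + 1 ≤ x) :
    (flip (d + 1) i φ).1 x = x := by
  have hv : (φ.1 x : ℕ) = x := by rw [h1 x hx]
  unfold flip
  split_ifs with h
  · apply Fin.ext
    rw [swapAt_val (by omega)]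
    split_ifs <;> omega
  · exact h1 x hx

lemma val_apply_lt_iff {d : ℕ} {p : Equiv.Perm (Fin n)} (h1 : ∀ x : Fin n, d ≤ x → p x = x)
    (x : Fin n) : (p x : ℕ) < d ↔ (x : ℕ) < d := by
  constructor
  · intro h
    by_contra hx
    rw [h1 x (by omega)] at h
    exact hx h
  · intro h
    by_contra hx
    have := h1 (p x) (by omega)
    rw [p.injective this] at hx
    exact hx h

/-- Reverse the signs of the first `d` elements of `Fin n`. -/
def negBelow (d : ℕ) (φ : Flag n) : Flag n :=
  (φ.1, fun x => if (x : ℕ) < d then !φ.2 x else φ.2 x)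

lemma negBelow_negBelow (d : ℕ) (φ : Flag n) : negBelow d (negBelow d φ) = φ := by
  refine Prod.ext rfl (funext fun x => ?_)
  by_cases h : (x : ℕ) < d <;> simp [negBelow, h]

lemma level_negBelow {d j : ℕ} (hj : j ≤ d) {φ : Flag n}
    (h1 : ∀ x : Fin n, d ≤ x → φ.1 x = x) : level (negBelow d φ) j = neg (level φ j) := by
  ext ⟨x, b⟩
  rw [mem_level, mem_neg, mem_level]
  refine and_congr_right fun hx => ?_
  have : (x : ℕ) < d := (val_apply_lt_iff h1 x).1 (lt_of_lt_of_le hx hj)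
  simp only [negBelow, this, if_true]
  cases φ.2 x <;> cases b <;> simp

/-- Count modulo 2 the pairs (φ, i) in which φ lies in the hemisphere of flags on d + 1 elements
with element d positive, and deleting level i + 1 leaves an alternating word. Counted by φ, they
give the flags alternating with either initial sign; by antipodality these are as many as all
alternating flags on d + 1 elements. On the other hand, flipping level i + 1 cancels all pairs but
those on the equator, which are the alternating flags on d elements. -/
lemma odd_card_alternatingFlags_succ {sgn : Finset (Fin n × Bool) → Bool}
    (hsgn : ∀ (φ : Flag n) (j : ℕ), 0 < j → j ≤ n → sgn (neg (level φ j)) = !sgn (level φ j))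
    {d : ℕ} (hd : d < n) :
    Odd (alternatingFlags sgn (d + 1)).card ↔ Odd (alternatingFlags sgn d).card := by
  classical
  let hemi : Finset (Flag n) := univ.filter fun φ =>
    (∀ x : Fin n, d + 1 ≤ x → φ.1 x = x) ∧ ∀ x : Fin n, d ≤ x → φ.2 x = true
  have mem_hemi : ∀ φ, φ ∈ hemi ↔ (∀ x : Fin n, d + 1 ≤ x → φ.1 x = x) ∧
      ∀ x : Fin n, d ≤ x → φ.2 x = true := by
    intro φ
    simp [hemi]
  let del : Flag n → ℕ → Prop := fun φ i =>
    (∀ k < i, sgn (level φ (k + 1)) = alt k) ∧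
      ∀ k < d, i ≤ k → sgn (level φ (k + 1 + 1)) = alt k
  let P := (hemi ×ˢ range (d + 1)).filter fun x => del x.1 x.2
  let pos := hemi.filter fun φ => Alternates sgn (d + 1) φ
  let negs := hemi.filter fun φ => ∀ k < d + 1, sgn (level φ (k + 1)) = !alt k
  have hP1 : Odd P.card ↔ Odd (pos.card + negs.card) := by
    rw [odd_card_sigma_iff hemi (range (d + 1)) del
      (fun φ => (∀ k < d + 1, sgn (level φ (k + 1)) = alt k) ∨
        (∀ k < d + 1, sgn (level φ (k + 1)) = !alt k))
      (fun φ _ => odd_card_deletions_iff d fun k => sgn (level φ (k + 1))), filter_or,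
      card_union_of_disjoint]
    · congr!
    · rw [disjoint_filter]
      intro φ _ h h'
      have h0 := h 0 (by omega)
      rw [h' 0 (by omega)] at h0
      simp at h0
  -- the pairs that are left alone by the involution
  let top : Fin n := ⟨d, hd⟩
  have hP2 : Odd P.card ↔ Odd (alternatingFlags sgn d).card := by
    have hsplit := card_filter_add_card_filter_not (s := P)
      (fun x : Flag n × ℕ => x.2 = d ∧ x.1.1 top = top)
    -- The flip leaves the hemisphere only when it reverses the sign of `top`, that is, when i = d
    -- and `top` is in position d.
    have heven : Even (P.filter fun x : Flag n × ℕ => ¬(x.2 = d ∧ x.1.1 top = top)).card := by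
      apply even_card_of_involution _ (fun x => (flip (d + 1) x.2 x.1, x.2))
      · rintro ⟨φ, i⟩ h
        simp only [P, mem_filter, mem_product, mem_range, mem_hemi, del] at h ⊢
        obtain ⟨⟨⟨⟨h1, h2⟩, hi⟩, h3, h4⟩, h5⟩ := h
        refine ⟨⟨⟨⟨flip_fixes h1, ?_⟩, hi⟩, ?_, ?_⟩, ?_⟩
        · intro x hx
          unfold flip
          split_ifs with h
          · exact h2 x hx
          · have hid : i = d := by omega
            have hne : (φ.1 x : ℕ) ≠ i := by
              intro hxi
              rcases Nat.lt_or_ge d x with hlt | hge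
              · rw [h1 x hlt] at hxi
                omega
              · have hxt : x = top := Fin.ext (by simp only [top]; omega)
                refine h5 ⟨hid, Fin.ext ?_⟩
                rw [← hxt, hxi, hid, hxt]
            simp only [signAt, hne, if_false]
            exact h2 x hx
        · intro k hk
          rw [level_flip (by omega) hi (by omega) (by omega)]
          exact h3 k hk
        · intro k hk hik
          rw [level_flip (by omega) hi (by omega) (by omega)]
          exact h4 k hk hik
        · rintro ⟨hid, ht⟩
          refine h5 ⟨hid, ?_⟩
          simpa [flip, hid, signAt] using ht
      · rintro ⟨φ, i⟩ h he
        simp only [P, mem_filter, mem_product, mem_range] at h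
        exact flip_ne (by omega) h.1.1.2 φ (congrArg Prod.fst he)
      · rintro ⟨φ, i⟩ h
        simp only [flip_flip (show d + 1 ≤ n by omega)]
    have hfix : (P.filter fun x : Flag n × ℕ => x.2 = d ∧ x.1.1 top = top).card =
        (alternatingFlags sgn d).card := by
      apply card_nbij' (fun x => x.1) (fun φ => (φ, d))
      · rintro ⟨φ, i⟩ h
        simp only [P, coe_filter, mem_filter, mem_product, mem_range, mem_hemi, del,
          Set.mem_ofPred_eq] at h
        obtain ⟨⟨⟨⟨h1, h2⟩, hi⟩, h3, h4⟩, rfl, h5⟩ := h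
        simp only [alternatingFlags, coe_filter, mem_univ, true_and, Set.mem_ofPred_eq]
        refine ⟨fun x hx => ⟨?_, h2 x hx⟩, h3⟩
        rcases Nat.lt_or_ge i x with hlt | hge
        · exact h1 x hlt
        · have hxt : x = top := Fin.ext (by simp only [top]; omega)
          rw [hxt, h5]
      · intro φ h
        simp only [alternatingFlags, coe_filter, mem_univ, true_and, Set.mem_ofPred_eq] at h
        simp only [P, coe_filter, mem_filter, mem_product, mem_range, mem_hemi, del,
          Set.mem_ofPred_eq]
        exact ⟨⟨⟨⟨fun x hx => (h.1 x (by omega)).1, fun x hx => (h.1 x hx).2⟩, by omega⟩,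
          h.2, fun k _ _ => by omega⟩, trivial, (h.1 top le_rfl).1⟩
      · rintro ⟨φ, i⟩ h
        simp only [coe_filter, Set.mem_ofPred_eq] at h
        simp [h.2.1]
      · intro φ _
        rfl
    rw [← hsplit, hfix, Nat.odd_add]
    simp only [heven, iff_true]
  have hA : (alternatingFlags sgn (d + 1)).card = pos.card + negs.card := by
    rw [← card_filter_add_card_filter_not (s := alternatingFlags sgn (d + 1))
      (fun φ => φ.2 top = true)]
    congr 1
    · congr 1
      ext φ
      simp only [alternatingFlags, pos, mem_filter, mem_univ, true_and, mem_hemi]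
      constructor
      · rintro ⟨⟨h1, h2⟩, h3⟩
        refine ⟨⟨fun x hx => (h1 x hx).1, fun x hx => ?_⟩, h2⟩
        rcases Nat.lt_or_ge d x with hlt | hge
        · exact (h1 x hlt).2
        · have hxt : x = top := Fin.ext (by simp only [top]; omega)
          rw [hxt, h3]
      · rintro ⟨⟨h1, h2⟩, h3⟩
        exact ⟨⟨fun x hx => ⟨h1 x hx, h2 x (by omega)⟩, h3⟩, h2 top le_rfl⟩
    · apply card_nbij' (negBelow (d + 1)) (negBelow (d + 1))
      · intro φ h
        simp only [alternatingFlags, coe_filter, mem_filter, mem_univ, true_and,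
          Set.mem_ofPred_eq] at h
        obtain ⟨⟨h1, h2⟩, h3⟩ := h
        simp only [negs, coe_filter, mem_hemi, Set.mem_ofPred_eq]
        refine ⟨⟨fun x hx => (h1 x hx).1, fun x hx => ?_⟩, fun k hk => ?_⟩
        · rcases Nat.lt_or_ge d x with hlt | hge
          · simp only [negBelow, show ¬ (x : ℕ) < d + 1 by omega, if_false]
            exact (h1 x hlt).2
          · have hxt : x = top := Fin.ext (by simp only [top]; omega)
            rw [hxt]
            simpa [negBelow, top] using h3
        · rw [level_negBelow (by omega) fun x hx => (h1 x hx).1,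
            hsgn _ _ (by omega) (by omega), h2 k hk]
      · intro φ h
        simp only [negs, coe_filter, mem_hemi, Set.mem_ofPred_eq] at h
        obtain ⟨⟨h1, h2⟩, h3⟩ := h
        simp only [alternatingFlags, coe_filter, mem_filter, mem_univ, true_and,
          Set.mem_ofPred_eq]
        refine ⟨⟨fun x hx => ⟨h1 x hx, ?_⟩, fun k hk => ?_⟩, ?_⟩
        · simp only [negBelow, show ¬ (x : ℕ) < d + 1 by omega, if_false]
          exact h2 x (by omega)
        · rw [level_negBelow (by omega) h1, hsgn _ _ (by omega) (by omega), h3 k hk, Bool.not_not]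
        · simpa [negBelow, top] using h2 top le_rfl
      · intro φ _
        exact negBelow_negBelow _ φ
      · intro φ _
        exact negBelow_negBelow _ φ
  rw [hA, ← hP1, hP2]

/-- **Fan's lemma**, parity version: for every antipodal assignment of signs to the signed sets, the
number of full flags along which the signs alternate is odd. -/
theorem odd_card_alternating {sgn : Finset (Fin n × Bool) → Bool}
    (hsgn : ∀ (φ : Flag n) (j : ℕ), 0 < j → j ≤ n → sgn (neg (level φ j)) = !sgn (level φ j)) :
    Odd (alternatingFlags sgn n).card := by
  have key : ∀ d ≤ n, Odd (alternatingFlags sgn d).card := by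
    intro d
    induction d with
    | zero =>
      intro _
      have : alternatingFlags sgn 0 = {((1 : Equiv.Perm (Fin n)), fun _ => true)} := by
        ext φ
        simp only [alternatingFlags, mem_filter, mem_univ, true_and, mem_singleton]
        constructor
        · rintro ⟨h, -⟩
          exact Prod.ext (Equiv.ext fun x => (h x (Nat.zero_le _)).1)
            (funext fun x => (h x (Nat.zero_le _)).2)
        · rintro rfl
          exact ⟨fun x _ => ⟨rfl, rfl⟩, fun k hk => by omega⟩
      simp [this]
    | succ d ih =>
      intro hd
      exact (odd_card_alternatingFlags_succ hsgn hd).2 (ih (by omega))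
  exact key n le_rfl

/-! ### The local degree of a monotone map between signed sets -/

/-- A map from a set with one more element than `S` covers `S` after the deletion of one element in
an odd number of ways precisely if it covers `S` and also takes a value outside `S`. -/
lemma odd_card_doors_iff {ι β : Type*} [DecidableEq ι] [DecidableEq β] (U : Finset ι)
    (S : Finset β) (g : ι → β) (hc : U.card = S.card + 1) :
    Odd (U.filter fun i => S ⊆ (U.erase i).image g).card ↔
      S ⊆ U.image g ∧ ∃ y ∈ U.image g, y ∉ S := by
  by_cases hS : S ⊆ U.image g
  swap
  · have : (U.filter fun i => S ⊆ (U.erase i).image g) = ∅ := by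
      rw [filter_eq_empty_iff]
      exact fun i _ h => hS (h.trans (image_subset_image (erase_subset i U)))
    simp [this, hS]
  by_cases hy : ∃ y ∈ U.image g, y ∉ S
  · simp only [hS, hy, and_self, iff_true]
    obtain ⟨y, hyU, hyS⟩ := hy
    obtain ⟨a, haU, rfl⟩ := mem_image.1 hyU
    have hins : insert (g a) S ⊆ U.image g := insert_subset hyU hS
    -- S and the extra value together use up all of U, so only the preimage of the extra value is
    -- dispensable.
    have hinj : Set.InjOn g U := by
      apply injOn_of_card_image_eq
      apply le_antisymm card_image_le
      rw [hc, ← card_insert_of_notMem hyS]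
      exact card_le_card hins
    have : (U.filter fun i => S ⊆ (U.erase i).image g) = {a} := by
      ext i
      rw [mem_filter, mem_singleton]
      constructor
      · rintro ⟨hi, h⟩
        by_contra hia
        have h1 : insert (g a) S ⊆ (U.erase i).image g :=
          insert_subset (mem_image_of_mem g (mem_erase.2 ⟨Ne.symm hia, haU⟩)) h
        have h2 := (card_le_card h1).trans card_image_le
        rw [card_insert_of_notMem hyS, card_erase_of_mem hi] at h2
        omega
      · rintro rfl
        refine ⟨haU, fun z hz => ?_⟩
        obtain ⟨b, hb, rfl⟩ := mem_image.1 (hS hz)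
        refine mem_image_of_mem g (mem_erase.2 ⟨?_, hb⟩)
        rintro rfl
        exact hyS hz
    simp [this]
  · simp only [hS, hy, and_false, iff_false, Nat.not_odd_iff_even]
    push Not at hy
    have himage : U.image g = S := Subset.antisymm hy hS
    -- Now the image is S, one element smaller than U. Erasing a or b is harmless; erasing anything
    -- else keeps the collision and leaves too few values.
    obtain ⟨a, ha, b, hb, hab, hgab⟩ : ∃ a ∈ U, ∃ b ∈ U, a ≠ b ∧ g a = g b := by
      apply exists_ne_map_eq_of_card_lt_of_maps_to (t := S) (by omega)
      exact fun a ha => hy _ (mem_image_of_mem g ha)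
    have cover : ∀ c ∈ U, ∀ d ∈ U, c ≠ d → g c = g d → S ⊆ (U.erase c).image g := by
      intro c hc' d hd hcd hg z hz
      obtain ⟨e, he, rfl⟩ := mem_image.1 (hS hz)
      by_cases hec : e = c
      · rw [hec, hg]
        exact mem_image_of_mem g (mem_erase.2 ⟨hcd.symm, hd⟩)
      · exact mem_image_of_mem g (mem_erase.2 ⟨hec, he⟩)
    have : (U.filter fun i => S ⊆ (U.erase i).image g) = {a, b} := by
      ext i
      rw [mem_filter, mem_insert, mem_singleton]
      constructor
      · rintro ⟨hi, h⟩
        by_contra! hne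
        have hinj : Set.InjOn g (U.erase i) := by
          apply injOn_of_card_image_eq
          apply le_antisymm card_image_le
          rw [card_erase_of_mem hi, hc, Nat.add_sub_cancel]
          exact card_le_card h
        exact hab (hinj (mem_coe.2 (mem_erase.2 ⟨hne.1.symm, ha⟩))
          (mem_coe.2 (mem_erase.2 ⟨hne.2.symm, hb⟩)) hgab)
      · rintro (rfl | rfl)
        · exact ⟨ha, cover _ ha _ hb hab hgab⟩
        · exact ⟨hb, cover _ hb _ ha hab.symm hgab.symm⟩
    rw [this, card_pair hab]
    exact even_two

lemma level_injOn (F : Flag n) : Set.InjOn (level F) (Ioc 0 n) := by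
  intro i hi j hj h
  rw [mem_coe, mem_Ioc] at hi hj
  rw [← card_level F hi.2, ← card_level F hj.2, h]

lemma level_flip_ne {j : ℕ} (hj : j < n) (F : Flag n) :
    level (flip n j F) (j + 1) ≠ level F (j + 1) := by
  intro h
  set x := F.1.symm ⟨j, hj⟩ with hx
  have hFx : (F.1 x : ℕ) = j := by simp [hx]
  have hmem : (x, F.2 x) ∈ level F (j + 1) := mem_level.2 ⟨by omega, rfl⟩
  rw [← h, mem_level] at hmem
  unfold flip at hmem
  split_ifs at hmem with h1
  · rw [swapAt_val h1, if_pos hFx] at hmem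
    omega
  · have := hmem.2
    simp [signAt, hFx] at this

/-- A chain of signed sets that contains all levels of a flag but one has only two possibilities for
the missing level. -/
lemma eq_level_or_eq_level_flip {j : ℕ} (hj : j < n) (F : Flag n) {y : Finset (Fin n × Bool)}
    (hcons : IsConsistent y) (hne : y.Nonempty)
    (hcomp : ∀ k, 0 < k → k ≤ n → k ≠ j + 1 →
      y ≠ level F k ∧ (y ⊆ level F k ∨ level F k ⊆ y)) :
    y = level F (j + 1) ∨ y = level (flip n j F) (j + 1) := by
  -- With any other size, y would be comparable to a level of its own size and hence equal to it.
  have hcard : y.card = j + 1 := by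
    by_contra hcard
    obtain ⟨h1, h2⟩ := hcomp y.card hne.card_pos hcons.card_le hcard
    have hF := card_level F hcons.card_le
    rcases h2 with h2 | h2
    · exact h1 (eq_of_subset_of_card_le h2 hF.le)
    · exact h1 (eq_of_subset_of_card_le h2 hF.ge).symm
  have hlow : level F j ⊆ y := by
    rcases Nat.eq_zero_or_pos j with h0 | h0
    · simp [h0, level_zero]
    · rcases (hcomp j h0 hj.le (by omega)).2 with h | h
      · have := card_le_card h
        rw [card_level F hj.le] at this
        omega
      · exact h
  have hhigh : j + 1 < n → y ⊆ level F (j + 1 + 1) := by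
    intro h1
    rcases (hcomp (j + 1 + 1) (by omega) h1 (by omega)).2 with h | h
    · exact h
    · have := card_le_card h
      rw [card_level F h1] at this
      omega
  obtain ⟨⟨x, b⟩, hxy, hxF⟩ : ∃ z ∈ y, z ∉ level F j := by
    apply exists_mem_notMem_of_card_lt_card
    rw [card_level F hj.le]
    omega
  have hpos : j ≤ F.1 x := by
    by_contra hlt
    have hx : (x, F.2 x) ∈ level F j := mem_level.2 ⟨by omega, rfl⟩
    exact hxF (mem_level.2 ⟨by omega, hcons x _ _ (hlow hx) hxy⟩)
  have hyins : ∀ G : Flag n, level G j = level F j → (x, b) ∈ level G (j + 1) →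
      y = level G (j + 1) := by
    intro G hG hx
    have hy : insert (x, b) (level F j) = y := by
      apply eq_of_subset_of_card_le (insert_subset hxy hlow)
      rw [card_insert_of_notMem hxF, card_level F hj.le, hcard]
    rw [← hy]
    apply eq_of_subset_of_card_le
    · refine insert_subset hx ?_
      rw [← hG]
      exact level_mono G (by omega)
    · rw [card_insert_of_notMem hxF, card_level F hj.le, card_level G hj]
  have hflip : level (flip n j F) j = level F j :=
    level_flip le_rfl hj hj.le (by omega) F
  by_cases h1 : j + 1 < n
  · have hx := mem_level.1 (hhigh h1 hxy)
    rcases hpos.eq_or_lt with hp | hp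
    · exact Or.inl (hyins F rfl (mem_level.2 ⟨by omega, hx.2⟩))
    · refine Or.inr (hyins _ hflip (mem_level.2 ?_))
      rw [flip, if_pos h1, swapAt_val h1]
      refine ⟨?_, hx.2⟩
      split_ifs <;> omega
  · have hp : (F.1 x : ℕ) = j := by
      have := (F.1 x).2
      omega
    by_cases hb : F.2 x = b
    · exact Or.inl (hyins F rfl (mem_level.2 ⟨by omega, hb⟩))
    · refine Or.inr (hyins _ hflip (mem_level.2 ?_))
      rw [flip, if_neg h1]
      refine ⟨by simp [signAt, hp], ?_⟩
      simp only [signAt, hp, if_true]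
      exact Bool.not_eq_eq_eq_not.2 (Bool.eq_not_of_ne hb)

/-! ### Parity of the number of flags above a given flag -/

section LocalDegree

variable {t m : ℕ} (f : Finset (Fin n × Bool) → Finset (Fin t × Bool)) (φ₀ : Flag n)

/-- The values of `f` on the levels above `m` of a flag. -/
def upperValues (m : ℕ) (φ : Flag n) : Finset (Finset (Fin t × Bool)) :=
  (Ioc m n).image fun i => f (level φ i)

open Classical in
/-- The flags that begin with the first `m` levels of `φ₀` and whose upper levels are mapped by `f`
onto the flag `F`. -/
noncomputable def flagsOver (m : ℕ) (F : Flag t) : Finset (Flag n) :=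
  univ.filter fun φ => (∀ i ≤ m, level φ i = level φ₀ i) ∧
    ∀ k ∈ Ioc 0 t, level F k ∈ upperValues f m φ

variable {f}

/-- A door is a pair (φ, i) such that the values at the upper levels other than i cover all levels
of F but level j + 1. Doors pair off, so their number is even. A flag φ lies in an odd number of
doors precisely when its values also include level j + 1 of F or of its flip: these are the only
ways to complete the chain. -/
lemma odd_card_flagsOver_flip (hn : m + t = n) (hmono : ∀ X Y, X ⊆ Y → f X ⊆ f Y)
    (hcons : ∀ X, IsConsistent X → IsConsistent (f X))
    (hne : ∀ X, IsConsistent X → m < X.card → (f X).Nonempty)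
    (F : Flag t) {j : ℕ} (hj : j < t) :
    Odd (flagsOver f φ₀ m (flip t j F)).card ↔ Odd (flagsOver f φ₀ m F).card := by
  classical
  let D : Finset (Flag n) := univ.filter fun φ => ∀ i ≤ m, level φ i = level φ₀ i
  let S : Finset (Finset (Fin t × Bool)) := ((Ioc 0 t).erase (j + 1)).image (level F)
  have hjmem : j + 1 ∈ Ioc 0 t := mem_Ioc.2 ⟨by omega, hj⟩
  have hS : S.card + 1 = t := by
    rw [card_image_of_injOn ((level_injOn F).mono (coe_subset.2 (erase_subset _ _))),
      card_erase_of_mem hjmem, Nat.card_Ioc]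
    omega
  have hU : (Ioc m n).card = S.card + 1 := by
    rw [hS, Nat.card_Ioc]
    omega
  have notMem : ∀ G : Flag t, level G (j + 1) ∉ S := by
    intro G hG
    obtain ⟨k, hk, hkG⟩ := mem_image.1 hG
    rw [mem_erase, mem_Ioc] at hk
    have := congrArg card hkG
    rw [card_level F hk.2.2, card_level G hj] at this
    exact hk.1 this
  have hflip : ∀ k ∈ Ioc 0 t, k ≠ j + 1 → level (flip t j F) k = level F k := by
    intro k hk hkj
    exact level_flip le_rfl hj (mem_Ioc.1 hk).2 hkj F
  have over_iff : ∀ G : Flag t, (∀ k ∈ Ioc 0 t, k ≠ j + 1 → level G k = level F k) →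
      ∀ φ : Flag n, (∀ k ∈ Ioc 0 t, level G k ∈ upperValues f m φ) ↔
        S ⊆ upperValues f m φ ∧ level G (j + 1) ∈ upperValues f m φ := by
    intro G hG φ
    constructor
    · intro h
      refine ⟨?_, h _ hjmem⟩
      intro z hz
      obtain ⟨k, hk, rfl⟩ := mem_image.1 hz
      rw [mem_erase] at hk
      rw [← hG k hk.2 hk.1]
      exact h k hk.2
    · rintro ⟨h1, h2⟩ k hk
      by_cases hkj : k = j + 1
      · rwa [hkj]
      · rw [hG k hk hkj]
        exact h1 (mem_image_of_mem _ (mem_erase.2 ⟨hkj, hk⟩))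
  let P := (D ×ˢ Ioc m n).filter fun x =>
    S ⊆ ((Ioc m n).erase x.2).image fun i => f (level x.1 i)
  -- `flip n (i - 1)` changes level i alone, which the door condition ignores; as i > m, the
  -- prescribed lower levels survive.
  have hEven : Even P.card := by
    apply even_card_of_involution _ (fun x => (flip n (x.2 - 1) x.1, x.2))
    · rintro ⟨φ, i⟩ h
      simp only [P, D, mem_filter, mem_product, mem_univ, true_and, mem_Ioc] at h ⊢
      obtain ⟨⟨h1, h2⟩, h3⟩ := h
      refine ⟨⟨fun k hk => ?_, h2⟩, ?_⟩
      · rw [level_flip le_rfl (by omega) (by omega) (by omega), h1 k hk]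
      · convert h3 using 1
        apply image_congr
        intro k hk
        rw [mem_coe, mem_erase, mem_Ioc] at hk
        simp only
        rw [level_flip le_rfl (by omega) (by omega) (by omega)]
    · rintro ⟨φ, i⟩ h he
      simp only [P, mem_filter, mem_product, mem_Ioc] at h
      exact flip_ne le_rfl (by omega) φ (congrArg Prod.fst he)
    · rintro ⟨φ, i⟩ h
      simp only [flip_flip le_rfl]
  have hodd : Odd P.card ↔
      Odd ((flagsOver f φ₀ m F).card + (flagsOver f φ₀ m (flip t j F)).card) := by
    rw [odd_card_sigma_iff D (Ioc m n)
      (fun φ i => S ⊆ ((Ioc m n).erase i).image fun i => f (level φ i))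
      (fun φ => (∀ k ∈ Ioc 0 t, level F k ∈ upperValues f m φ) ∨
        ∀ k ∈ Ioc 0 t, level (flip t j F) k ∈ upperValues f m φ), filter_or,
      card_union_of_disjoint]
    · simp only [flagsOver, D, filter_filter]
    · refine disjoint_left.2 fun φ h h' => ?_
      simp only [mem_filter] at h h'
      replace h := h.2
      replace h' := h'.2
      rw [over_iff F (fun _ _ _ => rfl)] at h
      rw [over_iff _ hflip] at h'
      -- Covering both flags would need t + 1 values on t levels.
      have hsub : insert (level F (j + 1)) (insert (level (flip t j F) (j + 1)) S) ⊆
          upperValues f m φ := insert_subset h.2 (insert_subset h'.2 h.1)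
      have hle := (card_le_card hsub).trans (card_image_le.trans hU.le)
      rw [card_insert_of_notMem, card_insert_of_notMem (notMem _)] at hle
      · omega
      · rw [mem_insert, not_or]
        exact ⟨(level_flip_ne hj F).symm, notMem _⟩
    · intro φ _
      rw [odd_card_doors_iff _ _ _ hU, over_iff F (fun _ _ _ => rfl), over_iff _ hflip]
      change S ⊆ upperValues f m φ ∧ (∃ y ∈ upperValues f m φ, y ∉ S) ↔ _
      rw [← and_or_left]
      refine and_congr_right fun hSφ => ⟨?_, ?_⟩
      · rintro ⟨y, hy, hyS⟩
        obtain ⟨i, hi, rfl⟩ := mem_image.1 hy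
        rw [mem_Ioc] at hi
        have hlc := level_isConsistent φ i
        have hcomp : ∀ k, 0 < k → k ≤ t → k ≠ j + 1 → f (level φ i) ≠ level F k ∧
            (f (level φ i) ⊆ level F k ∨ level F k ⊆ f (level φ i)) := by
          intro k hk0 hkt hkj
          have hkS : level F k ∈ S :=
            mem_image_of_mem _ (mem_erase.2 ⟨hkj, mem_Ioc.2 ⟨hk0, hkt⟩⟩)
          refine ⟨fun he => hyS (he ▸ hkS), ?_⟩
          obtain ⟨l, -, hl⟩ := mem_image.1 (hSφ hkS)
          rw [← hl]
          rcases le_total i l with h | h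
          · exact Or.inl (hmono _ _ (level_mono φ h))
          · exact Or.inr (hmono _ _ (level_mono φ h))
        rcases eq_level_or_eq_level_flip hj F (hcons _ hlc)
          (hne _ hlc (by rw [card_level φ hi.2]; exact hi.1)) hcomp with h | h
        · exact Or.inl (h ▸ hy)
        · exact Or.inr (h ▸ hy)
      · rintro (h | h)
        · exact ⟨_, h, notMem _⟩
        · exact ⟨_, h, notMem _⟩
  have := Nat.not_odd_iff_even.2 hEven
  rw [hodd, Nat.odd_add, ← Nat.not_odd_iff_even] at this
  tauto

end LocalDegree

/-- A property of flags that is preserved by all flips is preserved by all permutations. -/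
lemma of_flip_invariant_perm {Q : Flag n → Prop} (hQ : ∀ F, ∀ j < n, Q (flip n j F) ↔ Q F)
    (σ p : Equiv.Perm (Fin n)) (s : Fin n → Bool) : Q (p, s) ↔ Q (σ * p, s) := by
  obtain _ | r := n
  · rw [Subsingleton.elim σ 1, one_mul]
  have hσ : σ ∈ Submonoid.closure
      (Set.range fun i : Fin r ↦ Equiv.swap i.castSucc i.succ) := by
    rw [Equiv.Perm.mclosure_swap_castSucc_succ]
    exact Submonoid.mem_top σ
  induction hσ using Submonoid.closure_induction generalizing p with
  | mem τ hτ =>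
    obtain ⟨i, rfl⟩ := hτ
    have hi : (i : ℕ) + 1 < r + 1 := by omega
    -- A flip below the last position is left multiplication by an adjacent transposition, and these
    -- generate all permutations.
    rw [← hQ (p, s) i (by omega), flip, if_pos hi, swapAt, dif_pos hi]
    rfl
  | one => rw [one_mul]
  | mul σ τ _ _ ihσ ihτ => rw [mul_assoc]; exact (ihτ p).trans (ihσ (τ * p))

/-- From a given flag one can reach, by flips, a flag that begins with a given signed element. -/
lemma exists_level_one_of_flip_invariant {Q : Flag n → Prop}
    (hQ : ∀ F, ∀ j < n, Q (flip n j F) ↔ Q F) (hex : ∃ F, Q F) (k : Fin n) (b : Bool) :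
    ∃ F, Q F ∧ level F 1 = {(k, b)} := by
  obtain ⟨⟨p, s⟩, hF⟩ := hex
  have hn : 0 < n := k.pos
  have hperm : ∀ p q s, Q (p, s) → Q (q, s) := by
    intro p q s h
    have := (of_flip_invariant_perm hQ (q * p⁻¹) p s).1 h
    rwa [inv_mul_cancel_right] at this
  obtain ⟨s', hs', hs'k⟩ : ∃ s', Q (p, s') ∧ s' k = b := by
    by_cases hb : s k = b
    · exact ⟨s, hF, hb⟩
    -- Move k to the last position, where the flip is a sign change, and move it back.
    · let q : Equiv.Perm (Fin n) := Equiv.swap k ⟨n - 1, by omega⟩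
      have hqk : (q k : ℕ) = n - 1 := by simp [q]
      have h1 := (hQ (q, s) (n - 1) (by omega)).2 (hperm p q s hF)
      rw [flip, if_neg (by omega)] at h1
      refine ⟨_, hperm _ p _ h1, ?_⟩
      simp only [hqk, if_true]
      exact Bool.not_eq_eq_eq_not.2 (Bool.eq_not_of_ne hb)
  refine ⟨(Equiv.swap k ⟨0, hn⟩, s'), hperm p _ s' hs', ?_⟩
  symm
  apply eq_of_subset_of_card_le
  · rw [singleton_subset_iff, mem_level]
    simp [hs'k]
  · rw [card_level _ hn, card_singleton]

/-- If the local degree of `f` above the first `m` levels of `φ₀` is odd, then `f` maps suitable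
one-element extensions of level `m` to all the singletons. -/
theorem exists_insert_eq_singleton {t m : ℕ} {f : Finset (Fin n × Bool) → Finset (Fin t × Bool)}
    (φ₀ : Flag n) (hn : m + t = n) (hmono : ∀ X Y, X ⊆ Y → f X ⊆ f Y)
    (hcons : ∀ X, IsConsistent X → IsConsistent (f X))
    (hne : ∀ X, IsConsistent X → m < X.card → (f X).Nonempty)
    (hodd : ∃ F : Flag t, Odd (flagsOver f φ₀ m F).card) (k : Fin t) (b : Bool) :
    ∃ v b', (∀ b'', (v, b'') ∉ level φ₀ m) ∧ f (insert (v, b') (level φ₀ m)) = {(k, b)} := by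
  obtain ⟨F, hF, hF1⟩ := exists_level_one_of_flip_invariant
    (fun F j hj => odd_card_flagsOver_flip φ₀ hn hmono hcons hne F hj) hodd k b
  obtain ⟨φ, hφ⟩ := card_pos.1 hF.pos
  simp only [flagsOver, mem_filter, mem_univ, true_and] at hφ
  obtain ⟨h1, h2⟩ := hφ
  have ht : 0 < t := k.pos
  have hm : m < n := by omega
  obtain ⟨i, hi, hfi⟩ := mem_image.1 (h2 1 (mem_Ioc.2 ⟨by omega, ht⟩))
  rw [mem_Ioc] at hi
  have hfm : f (level φ (m + 1)) = {(k, b)} := by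
    have hsub : f (level φ (m + 1)) ⊆ {(k, b)} := by
      rw [← hF1, ← hfi]
      exact hmono _ _ (level_mono φ hi.1)
    refine (subset_singleton_iff.1 hsub).resolve_left ?_
    refine (hne _ (level_isConsistent φ _) ?_).ne_empty
    rw [card_level φ hm]
    omega
  set v := φ.1.symm ⟨m, hm⟩ with hv
  have hφv : (φ.1 v : ℕ) = m := by simp [hv]
  refine ⟨v, φ.2 v, fun b'' hb => ?_, ?_⟩
  · rw [← h1 m le_rfl, mem_level] at hb
    omega
  · rw [← hfm, ← h1 m le_rfl]
    congr 1
    apply eq_of_subset_of_card_le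
    · exact insert_subset (mem_level.2 ⟨by omega, rfl⟩) (level_mono φ (by omega))
    · rw [card_level φ hm, card_insert_of_notMem, card_level φ hm.le]
      rw [mem_level]
      omega

/-! ### Monotone antipodal maps between signed sets -/

lemma eq_self_of_strictMono_of_lt {t : ℕ} {a : ℕ → ℕ} (h : ∀ j, j + 1 < t → a j < a (j + 1))
    (hlt : ∀ j < t, a j < t) : ∀ j < t, a j = j := by
  have lower : ∀ j < t, j ≤ a j := by
    intro j
    induction j with
    | zero => exact fun _ => Nat.zero_le _
    | succ j ih =>
      intro hj
      have := ih (by omega)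
      have := h j hj
      omega
  have upper : ∀ i j, j + i + 1 = t → a j ≤ j := by
    intro i
    induction i with
    | zero =>
      intro j hj
      have := hlt j (by omega)
      omega
    | succ i ih =>
      intro j hj
      have := ih (j + 1) (by omega)
      have := h j (by omega)
      omega
  intro j hj
  exact le_antisymm (upper (t - 1 - j) j (by omega)) (lower j hj)

open Classical in
/-- The sign of the largest element of a signed set. -/
noncomputable def topSign (Y : Finset (Fin n × Bool)) : Bool :=
  decide (∃ x, (x, true) ∈ Y ∧ ∀ z ∈ Y, z.1 ≤ x)

lemma exists_top {Y : Finset (Fin n × Bool)} (h : Y.Nonempty) :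
    ∃ x b, (x, b) ∈ Y ∧ ∀ z ∈ Y, z.1 ≤ x := by
  obtain ⟨⟨x, b⟩, hx, hmax⟩ := exists_max_image Y Prod.fst h
  exact ⟨x, b, hx, hmax⟩

lemma topSign_eq {Y : Finset (Fin n × Bool)} (hY : IsConsistent Y) {x : Fin n} {b : Bool}
    (hx : (x, b) ∈ Y) (hmax : ∀ z ∈ Y, z.1 ≤ x) : topSign Y = b := by
  cases b with
  | true =>
    simp only [topSign, decide_eq_true_eq]
    exact ⟨x, hx, hmax⟩
  | false =>
    simp only [topSign, decide_eq_false_iff_not]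
    rintro ⟨y, hy, hy'⟩
    have hxy : x = y := le_antisymm (hy' _ hx) (hmax _ hy)
    rw [hxy] at hx
    exact absurd (hY y _ _ hx hy) (by decide)

lemma neg_isConsistent {Y : Finset (Fin n × Bool)} (hY : IsConsistent Y) :
    IsConsistent (neg Y) := by
  intro x b b' h h'
  rw [mem_neg] at h h'
  simpa using hY x _ _ h h'

lemma neg_eq_empty_iff {Y : Finset (Fin n × Bool)} : neg Y = ∅ ↔ Y = ∅ := by
  simp only [eq_empty_iff_forall_notMem]
  constructor
  · rintro h ⟨x, b⟩ hx
    exact h (x, !b) (by rwa [mem_neg, Bool.not_not])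
  · rintro h ⟨x, b⟩ hx
    exact h _ (mem_neg.1 hx)

lemma topSign_neg {Y : Finset (Fin n × Bool)} (hY : IsConsistent Y) (hne : Y.Nonempty) :
    topSign (neg Y) = !topSign Y := by
  obtain ⟨x, b, hx, hmax⟩ := exists_top hne
  rw [topSign_eq hY hx hmax]
  apply topSign_eq (neg_isConsistent hY) (x := x)
  · rwa [mem_neg, Bool.not_not]
  · rintro ⟨z, b'⟩ hz
    exact hmax (z, !b') (mem_neg.1 hz)

lemma top_lt_top {Y Y' : Finset (Fin n × Bool)} (hY : IsConsistent Y') (hsub : Y ⊆ Y')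
    {x x' : Fin n} {b b' : Bool} (hx : (x, b) ∈ Y) (hx' : (x', b') ∈ Y')
    (hmax' : ∀ z ∈ Y', z.1 ≤ x') (hb : b ≠ b') : x < x' := by
  refine lt_of_le_of_ne (hmax' _ (hsub hx)) ?_
  rintro rfl
  exact hb (hY x _ _ (hsub hx) hx')

/-- A chain of `t` signed subsets of `Fin t` whose top signs alternate is the standard flag. -/
lemma eq_level_of_alternates {t : ℕ} {G : ℕ → Finset (Fin t × Bool)}
    (hmono : ∀ i j, i ≤ j → G i ⊆ G j) (hcons : ∀ j, j ≤ t → IsConsistent (G j))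
    (hne : ∀ j, 0 < j → j ≤ t → (G j).Nonempty) {τ : ℕ → Bool} (hτ : ∀ j, τ (j + 1) = !τ j)
    (hG : ∀ j < t, topSign (G (j + 1)) = τ j) {j : ℕ} (hj : j < t) :
    G (j + 1) = level ((1 : Equiv.Perm (Fin t)), fun x => τ x) (j + 1) := by
  have htop : ∀ j, ∃ x : ℕ, ∀ _ : j < t, ∃ hx : x < t, (⟨x, hx⟩, τ j) ∈ G (j + 1) ∧
      ∀ z ∈ G (j + 1), (z.1 : ℕ) ≤ x := by
    intro j
    by_cases hj : j < t
    · obtain ⟨x, b, hx, hmax⟩ := exists_top (hne (j + 1) (by omega) hj)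
      have := topSign_eq (hcons _ hj) hx hmax
      rw [hG j hj] at this
      rw [← this] at hx
      exact ⟨x, fun _ => ⟨x.2, hx, hmax⟩⟩
    · exact ⟨0, fun h => absurd h hj⟩
  choose a ha using htop
  -- Consecutive tops carry opposite signs, so by consistency they strictly increase; t increasing
  -- values below t are 0, …, t - 1.
  have haj : ∀ j < t, a j = j := by
    apply eq_self_of_strictMono_of_lt
    · intro j hj
      obtain ⟨h1, h2, -⟩ := ha j (by omega)
      obtain ⟨h4, h5, h6⟩ := ha (j + 1) hj
      have := top_lt_top (hcons _ hj) (hmono _ _ (Nat.le_succ _)) h2 h5 h6 (by simp [hτ])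
      exact this
    · intro j hj
      exact (ha j hj).1
  have hmem : ∀ k (hk : k < t), ((⟨k, hk⟩ : Fin t), τ k) ∈ G (k + 1) := by
    intro k hk
    obtain ⟨h1, h2, -⟩ := ha k hk
    simpa only [haj k hk] using h2
  ext ⟨x, b⟩
  rw [mem_level]
  change _ ↔ (x : ℕ) < j + 1 ∧ τ x = b
  constructor
  · intro hx
    have h1 : (x : ℕ) ≤ j := by
      have := (ha j hj).2.2 _ hx
      rwa [haj j hj] at this
    refine ⟨by omega, ?_⟩
    exact hcons _ hj x _ _ (hmono _ _ (by omega) (hmem x x.2)) hx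
  · rintro ⟨h1, rfl⟩
    exact hmono _ _ (by omega) (hmem x x.2)

/-- If the values of a monotone map on the upper levels of a flag cover a flag `F`, they run through
the levels of `F` in order. -/
lemma apply_level_eq_of_mem_upperValues {t m : ℕ}
    {f : Finset (Fin n × Bool) → Finset (Fin t × Bool)} (hn : m + t = n)
    (hmono : ∀ X Y, X ⊆ Y → f X ⊆ f Y) {φ : Flag n} {F : Flag t}
    (h : ∀ k ∈ Ioc 0 t, level F k ∈ upperValues f m φ) {j : ℕ} (hj : j < t) :
    f (level φ (m + j + 1)) = level F (j + 1) := by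
  have hidx : ∀ j, ∃ i : ℕ, ∀ _ : j < t, i < t ∧ f (level φ (m + i + 1)) = level F (j + 1) := by
    intro j
    by_cases hj : j < t
    · obtain ⟨i, hi, hfi⟩ := mem_image.1 (h (j + 1) (mem_Ioc.2 ⟨by omega, hj⟩))
      rw [mem_Ioc] at hi
      refine ⟨i - m - 1, fun _ => ⟨by omega, ?_⟩⟩
      rw [← hfi]
      congr 2
      omega
    · exact ⟨0, fun h => absurd h hj⟩
  choose a ha using hidx
  have haj : ∀ j < t, a j = j := by
    apply eq_self_of_strictMono_of_lt
    · intro j hj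
      by_contra hle
      have hsub := card_le_card (hmono _ _ (level_mono φ (show m + a (j + 1) + 1 ≤ m + a j + 1 by
        omega)))
      rw [(ha j (by omega)).2, (ha (j + 1) hj).2, card_level F hj, card_level F (by omega)] at hsub
      omega
    · exact fun j hj => (ha j hj).1
  have := (ha j hj).2
  rwa [haj j hj] at this

/-- A monotone antipodal map `f` from signed subsets of `Fin (m + t)` to signed subsets of `Fin t`
that vanishes only on sets of size at most `m` vanishes on some `Z` such that `f` maps one-element
extensions of `Z` to all the signed singletons. -/
theorem exists_forall_exists_insert_eq_singleton {t m : ℕ}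
    {f : Finset (Fin n × Bool) → Finset (Fin t × Bool)} (hn : m + t = n)
    (hmono : ∀ X Y, X ⊆ Y → f X ⊆ f Y) (hcons : ∀ X, IsConsistent X → IsConsistent (f X))
    (hneg : ∀ X, f (neg X) = neg (f X))
    (hne : ∀ X, IsConsistent X → m < X.card → (f X).Nonempty) :
    ∃ Z, IsConsistent Z ∧ f Z = ∅ ∧ ∀ k b, ∃ v b', (∀ b'', (v, b'') ∉ Z) ∧
      f (insert (v, b') Z) = {(k, b)} := by
  classical
  -- Where f vanishes, the top sign of X merely serves as an antipodal choice.
  let sgn : Finset (Fin n × Bool) → Bool := fun X => if f X = ∅ then topSign X else topSign (f X)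
  have sgn_of_ne : ∀ X, (f X).Nonempty → sgn X = topSign (f X) := fun X hX => if_neg hX.ne_empty
  have hsgn : ∀ (φ : Flag n) (j : ℕ), 0 < j → j ≤ n →
      sgn (neg (level φ j)) = !sgn (level φ j) := by
    intro φ j h0 hj
    have hc := level_isConsistent φ j
    simp only [sgn, hneg, neg_eq_empty_iff]
    split_ifs with hf
    · exact topSign_neg hc (level_nonempty φ h0 hj)
    · exact topSign_neg (hcons _ hc) (nonempty_iff_ne_empty.2 hf)
  have hupper : ∀ (φ : Flag n) j, 0 < j → j ≤ t → (f (level φ (m + j))).Nonempty := by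
    intro φ j h0 hj
    apply hne _ (level_isConsistent φ _)
    rw [card_level φ (by omega)]
    omega
  let τ : ℕ → Bool := fun j => alt (m + j)
  have hτ : ∀ j, τ (j + 1) = !τ j := fun j => alt_succ (m + j)
  let F₀ : Flag t := (1, fun x => τ x)
  have halt : ∀ φ : Flag n, Alternates sgn n φ → ∀ j < t,
      f (level φ (m + j + 1)) = level F₀ (j + 1) := by
    intro φ hφ j hj
    refine eq_level_of_alternates (G := fun j => f (level φ (m + j)))
      (fun i j hij => hmono _ _ (level_mono φ (by omega)))
      (fun j _ => hcons _ (level_isConsistent φ _)) (hupper φ) hτ (fun j hj => ?_) hj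
    rw [← sgn_of_ne _ (hupper φ (j + 1) (by omega) hj)]
    exact hφ (m + j) (by omega)
  -- A nonempty f (level m) would have top sign opposite to τ 0, yet lie inside f (level (m + 1)) =
  -- {(0, τ 0)}. For m = 0, f ∅ is both symmetric and consistent, hence empty.
  have hlow : ∀ φ : Flag n, Alternates sgn n φ → f (level φ m) = ∅ := by
    intro φ hφ
    rcases Nat.eq_zero_or_pos m with h0 | h0
    · have h1 : neg (∅ : Finset (Fin n × Bool)) = ∅ := neg_eq_empty_iff.2 rfl
      have h2 := hneg ∅
      rw [h1] at h2
      rw [h0, level_zero, eq_empty_iff_forall_notMem]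
      rintro ⟨x, b⟩ hx
      have hx' := hx
      rw [h2, mem_neg] at hx'
      have hc : IsConsistent (f ∅) := hcons _ (by rw [← level_zero φ]; exact level_isConsistent φ 0)
      have := hc x _ _ hx hx'
      simp at this
    · by_contra hne'
      obtain ⟨x, b, hx, hmax⟩ := exists_top (nonempty_iff_ne_empty.2 hne')
      have ht : 0 < t := x.pos
      have hb : τ 0 ≠ b := by
        have h1 := topSign_eq (hcons _ (level_isConsistent φ m)) hx hmax
        rw [← sgn_of_ne _ (nonempty_iff_ne_empty.2 hne')] at h1
        have h2 := hφ (m - 1) (by omega)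
        rw [show m - 1 + 1 = m by omega, h1] at h2
        have h3 : τ 0 = !alt (m - 1) := by
          rw [← alt_succ]
          simp only [τ]
          congr 1
          omega
        rw [h3, h2]
        simp
      have h1 := hmono _ _ (level_mono φ (show m ≤ m + 0 + 1 by omega)) hx
      rw [halt φ hφ 0 ht, mem_level] at h1
      change (x : ℕ) < 0 + 1 ∧ τ x = b at h1
      rw [show (x : ℕ) = 0 by omega] at h1
      exact hb h1.2
  obtain ⟨φ₀, hφ₀, hodd⟩ : ∃ φ₀ ∈ alternatingFlags sgn n, Odd ((alternatingFlags sgn n).filter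
      fun φ => (fun i : Fin (m + 1) => level φ i) = fun i : Fin (m + 1) => level φ₀ i).card := by
    by_contra! hcon
    have hA := odd_card_alternating hsgn
    rw [card_eq_sum_card_image (fun φ (i : Fin (m + 1)) => level φ i),
      ← Nat.not_even_iff_odd] at hA
    apply hA
    apply even_sum
    intro K hK
    obtain ⟨φ₀, h0, rfl⟩ := mem_image.1 hK
    exact Nat.not_odd_iff_even.1 (hcon φ₀ h0)
  have mem_alt : ∀ φ, φ ∈ alternatingFlags sgn n ↔ Alternates sgn n φ := by
    intro φ
    simp only [alternatingFlags, mem_filter, mem_univ, true_and, and_iff_right_iff_imp]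
    intro _ x hx
    omega
  -- Conversely, a flag over `F₀` alternates: up to level m it agrees with `φ₀`, and above m
  -- monotonicity makes it run through `F₀` in order.
  have hfiber : ((alternatingFlags sgn n).filter fun φ =>
      (fun i : Fin (m + 1) => level φ i) = fun i : Fin (m + 1) => level φ₀ i) =
      flagsOver f φ₀ m F₀ := by
    ext φ
    rw [mem_filter, mem_alt]
    simp only [flagsOver, mem_filter, mem_univ, true_and]
    constructor
    · rintro ⟨h1, h2⟩
      refine ⟨fun i hi => congrFun h2 ⟨i, by omega⟩, fun k hk => ?_⟩
      rw [mem_Ioc] at hk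
      obtain ⟨j, rfl⟩ : ∃ j, k = j + 1 := ⟨k - 1, by omega⟩
      rw [← halt φ h1 j hk.2]
      exact mem_image_of_mem _ (mem_Ioc.2 ⟨by omega, by omega⟩)
    · rintro ⟨h1, h2⟩
      refine ⟨fun k hk => ?_, funext fun i => h1 i (by omega)⟩
      rcases Nat.lt_or_ge k m with hkm | hkm
      · rw [h1 (k + 1) hkm]
        exact (mem_alt φ₀).1 hφ₀ k hk
      · obtain ⟨j, rfl⟩ : ∃ j, k = m + j := ⟨k - m, by omega⟩
        have hj : j < t := by omega
        rw [sgn_of_ne (level φ (m + j + 1)) (hupper φ (j + 1) (by omega) hj),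
          apply_level_eq_of_mem_upperValues hn hmono h2 hj]
        apply topSign_eq (level_isConsistent _ _) (x := ⟨j, hj⟩)
        · exact mem_level.2 ⟨Nat.lt_succ_self j, rfl⟩
        · rintro ⟨z, b⟩ hz
          exact Nat.lt_succ_iff.1 (mem_level.1 hz).1
  rw [hfiber] at hodd
  exact ⟨level φ₀ m, level_isConsistent φ₀ m, hlow φ₀ ((mem_alt φ₀).1 hφ₀),
    exists_insert_eq_singleton φ₀ hn hmono hcons hne ⟨F₀, hodd⟩⟩

end SignedSet

/-! ### Signed sets of vertices of a hypergraph -/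

namespace Hypergraph

open SignedSet

variable {α : Type*} {H : Hypergraph α} {n t : ℕ}

/-- An empty edge survives every deletion and is monochromatic, so no U qualifies. -/
lemma nonempty_of_cd2_ne_top (h : H.cd2 ≠ ⊤) {e : Set α} (he : e ∈ H.edgeSet) : e.Nonempty := by
  rw [Set.nonempty_iff_ne_empty]
  rintro rfl
  apply h
  simp only [cd2, iInf_eq_top]
  rintro U ⟨-, c, hc⟩
  exact absurd ⟨0, fun x hx => absurd hx (Set.notMem_empty x)⟩ (hc ∅ ⟨he, Set.empty_inter U⟩)

/-- The vertices that occur with sign `b` in a signed set, under an enumeration `e`. -/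
def side (e : Fin n → α) (X : Finset (Fin n × Bool)) (b : Bool) : Set α :=
  {a | ∃ x, (x, b) ∈ X ∧ e x = a}

lemma side_mono (e : Fin n → α) {X Y : Finset (Fin n × Bool)} (h : X ⊆ Y) (b : Bool) :
    side e X b ⊆ side e Y b := by
  rintro a ⟨x, hx, rfl⟩
  exact ⟨x, h hx, rfl⟩

lemma side_neg (e : Fin n → α) (X : Finset (Fin n × Bool)) (b : Bool) :
    side e (neg X) b = side e X (!b) := by
  simp [side]

lemma disjoint_side {e : Fin n → α} (he : Function.Injective e) {X : Finset (Fin n × Bool)}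
    (hX : IsConsistent X) {b b' : Bool} (hb : b ≠ b') : Disjoint (side e X b) (side e X b') := by
  rw [Set.disjoint_left]
  rintro a ⟨x, hx, rfl⟩ ⟨y, hy, hyx⟩
  rw [he hyx] at hy
  exact hb (hX x b b' hx hy)

open Classical in
/-- The signed set of colors of the edges contained in the two sides of a signed set of vertices. -/
noncomputable def signedColors (c : H.kneserGraph.Coloring (Fin t)) (e : Fin n → α)
    (X : Finset (Fin n × Bool)) : Finset (Fin t × Bool) :=
  Finset.univ.filter fun y => ∃ E : H.edgeSet, c E = y.1 ∧ (E : Set α) ⊆ side e X y.2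

lemma mem_signedColors {c : H.kneserGraph.Coloring (Fin t)} {e : Fin n → α}
    {X : Finset (Fin n × Bool)} {k : Fin t} {b : Bool} :
    (k, b) ∈ signedColors c e X ↔ ∃ E : H.edgeSet, c E = k ∧ (E : Set α) ⊆ side e X b := by
  simp [signedColors]

lemma kneserGraph_adj_of_disjoint {E F : H.edgeSet} (hE : (E : Set α).Nonempty)
    (h : Disjoint (E : Set α) F) : H.kneserGraph.Adj E F := by
  refine ⟨?_, h⟩
  rintro rfl
  rw [disjoint_self] at h
  exact hE.ne_empty h

lemma signedColors_mono (c : H.kneserGraph.Coloring (Fin t)) (e : Fin n → α)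
    (X Y : Finset (Fin n × Bool)) (h : X ⊆ Y) : signedColors c e X ⊆ signedColors c e Y := by
  rintro ⟨k, b⟩ hk
  rw [mem_signedColors] at hk ⊢
  obtain ⟨E, hE, hEX⟩ := hk
  exact ⟨E, hE, hEX.trans (side_mono e h b)⟩

lemma signedColors_neg (c : H.kneserGraph.Coloring (Fin t)) (e : Fin n → α)
    (X : Finset (Fin n × Bool)) : signedColors c e (neg X) = neg (signedColors c e X) := by
  ext ⟨k, b⟩
  rw [mem_neg, mem_signedColors, mem_signedColors, side_neg]

lemma signedColors_isConsistent (hne : ∀ E ∈ H.edgeSet, E.Nonempty)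
    (c : H.kneserGraph.Coloring (Fin t)) {e : Fin n → α} (he : Function.Injective e)
    (X : Finset (Fin n × Bool)) (hX : IsConsistent X) : IsConsistent (signedColors c e X) := by
  intro k b b' hk hk'
  rw [mem_signedColors] at hk hk'
  obtain ⟨E, hE, hEX⟩ := hk
  obtain ⟨F, hF, hFX⟩ := hk'
  by_contra hb
  refine c.valid (kneserGraph_adj_of_disjoint (hne E E.2) ?_) (hE.trans hF.symm)
  exact (disjoint_side he hX hb).mono hEX hFX

/-- A signed set neither side of which contains an edge leaves out at least `cd₂(H)` vertices. -/
lemma cd2_add_card_le {e : Fin n → α} (he : Function.Injective e) (hrange : Set.range e = H.vertexSet)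
    {X : Finset (Fin n × Bool)} (hX : IsConsistent X)
    (hfree : ∀ E ∈ H.edgeSet, ∀ b, ¬ E ⊆ side e X b) : H.cd2 + X.card ≤ n := by
  classical
  set s : Finset (Fin n) := X.image Prod.fst with hs
  have hcard : s.card = X.card := by
    apply Finset.card_image_of_injOn
    rintro ⟨x, b⟩ hx ⟨y, b'⟩ hy hxy
    obtain rfl : x = y := hxy
    rw [hX x b b' hx hy]
  have hle : H.cd2 ≤ (e '' (sᶜ : Finset (Fin n))).encard := by
    -- Delete the vertices outside X and color the rest by sign: a monochromatic edge would lie in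
    -- one side.
    refine iInf₂_le _ ⟨?_, fun a => if a ∈ side e X true then 1 else 0, ?_⟩
    · rw [← hrange]
      exact Set.image_subset_range _ _
    · rintro E ⟨hE, hEU⟩ ⟨k, hk⟩
      refine hfree E hE (decide (k = 1)) fun a ha => ?_
      obtain ⟨x, rfl⟩ : a ∈ Set.range e := by
        rw [hrange]
        exact H.subset_vertexSet_of_mem_edgeSet hE ha
      have hxs : x ∈ s := by
        by_contra hx
        have : e x ∈ E ∩ e '' (sᶜ : Finset (Fin n)) :=
          ⟨ha, Set.mem_image_of_mem e (Finset.mem_coe.2 (Finset.mem_compl.2 hx))⟩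
        rw [hEU] at this
        exact this
      obtain ⟨⟨y, b⟩, hy, rfl⟩ := Finset.mem_image.1 hxs
      have hka : (if e y ∈ side e X true then (1 : Fin 2) else 0) = k := hk _ ha
      cases b with
      | true =>
        rw [if_pos ⟨y, hy, rfl⟩] at hka
        rw [← hka]
        exact ⟨y, hy, rfl⟩
      | false =>
        rw [if_neg] at hka
        · rw [← hka]
          exact ⟨y, hy, rfl⟩
        · exact fun h => Set.disjoint_left.1 (disjoint_side he hX (by decide)) h
            (⟨y, hy, rfl⟩ : e y ∈ side e X false)
  rw [he.encard_image, Set.encard_coe_eq_coe_finsetCard] at hle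
  calc H.cd2 + X.card ≤ ((sᶜ).card : ℕ∞) + X.card := by gcongr
    _ = ((sᶜ.card + s.card : ℕ) : ℕ∞) := by rw [hcard, Nat.cast_add]
    _ = n := by rw [Finset.card_compl_add_card, Fintype.card_fin]

lemma side_insert_subset (e : Fin n → α) (Z : Finset (Fin n × Bool)) (v : Fin n) (b' b : Bool) :
    side e (insert (v, b') Z) b ⊆ insert (e v) (side e Z b) := by
  rintro a ⟨x, hx, rfl⟩
  rcases Finset.mem_insert.1 hx with h | h
  · exact Or.inl (congrArg e (congrArg Prod.fst h))
  · exact Or.inr ⟨x, h, rfl⟩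

lemma notMem_side {e : Fin n → α} (he : Function.Injective e) {Z : Finset (Fin n × Bool)}
    {v : Fin n} (hv : ∀ b, (v, b) ∉ Z) (b : Bool) : e v ∉ side e Z b := by
  rintro ⟨x, hx, hxv⟩
  rw [he hxv] at hx
  exact hv b hx

/-- If `signedColors` vanishes on `Z` and maps one-element extensions of `Z` to all the singletons,
then the edges so obtained form the required subgraph. -/
lemma exists_copy_of_insert_eq_singleton (hne : ∀ E ∈ H.edgeSet, E.Nonempty)
    (hsing : ∀ E ∈ H.edgeSet, ¬ ∃ x, E = {x}) (c : H.kneserGraph.Coloring (Fin t))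
    {e : Fin n → α} (he : Function.Injective e) {Z : Finset (Fin n × Bool)} (hZ : IsConsistent Z)
    (hfree : signedColors c e Z = ∅)
    (hins : ∀ k b, ∃ v b', (∀ b'', (v, b'') ∉ Z) ∧
      signedColors c e (insert (v, b') Z) = {(k, b)}) :
    ∃ f : SimpleGraph.Copy (completeBipartiteMinusMatching t) H.kneserGraph,
      (∀ i, c (f (Sum.inl i)) = i) ∧ ∀ j, c (f (Sum.inr j)) = j := by
  have key : ∀ k b, ∃ v, ∃ E : H.edgeSet, (∀ b'', (v, b'') ∉ Z) ∧
      signedColors c e (insert (v, b) Z) = {(k, b)} ∧ c E = k ∧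
      (E : Set α) ⊆ insert (e v) (side e Z b) := by
    intro k b
    obtain ⟨v, b', hv, hvb⟩ := hins k b
    obtain ⟨E, hE, hEX⟩ : ∃ E : H.edgeSet, c E = k ∧
        (E : Set α) ⊆ side e (insert (v, b') Z) b := by
      rw [← mem_signedColors, hvb]
      exact Finset.mem_singleton_self _
    -- Inserting v with the other sign would leave side b unchanged, putting E inside a side of Z.
    have hbb : b' = b := by
      by_contra hbb
      have : (k, b) ∈ signedColors c e Z := by
        rw [mem_signedColors]
        refine ⟨E, hE, fun a ha => ?_⟩
        obtain ⟨x, hx, rfl⟩ := hEX ha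
        rcases Finset.mem_insert.1 hx with h | h
        · exact absurd (congrArg Prod.snd h).symm hbb
        · exact ⟨x, h, rfl⟩
      simp [hfree] at this
    rw [hbb] at hvb hEX
    exact ⟨v, E, hv, hvb, hE, hEX.trans (side_insert_subset e Z v b b)⟩
  choose v E hv hcol hc hE using key
  have hvinj : ∀ k l b, v k b = v l b → k = l := by
    intro k l b h
    have h1 := hcol k b
    rw [h, hcol l b] at h1
    simpa using (Finset.singleton_injective h1).symm
  have hdisj : ∀ k l, v k true ≠ v l false → Disjoint (E k true : Set α) (E l false) := by
    intro k l h
    refine Disjoint.mono (hE k true) (hE l false) ?_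
    rw [Set.disjoint_insert_left, Set.disjoint_insert_right]
    refine ⟨?_, notMem_side he (hv l false) true, disjoint_side he hZ (by decide)⟩
    rw [Set.mem_insert_iff, not_or]
    exact ⟨fun h' => h (he h'), notMem_side he (hv k true) false⟩
  have hadj : ∀ k l, v k true ≠ v l false → H.kneserGraph.Adj (E k true) (E l false) :=
    fun k l h => kneserGraph_adj_of_disjoint (hne _ (E k true).2) (hdisj k l h)
  have hveq : ∀ k, v k true = v k false := by
    intro k
    by_contra h
    exact c.valid (hadj k k h) ((hc k true).trans (hc k false).symm)
  have hadj' : ∀ k l, k ≠ l → H.kneserGraph.Adj (E k true) (E l false) := by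
    intro k l h
    apply hadj
    rw [← hveq l]
    exact fun h' => h (hvinj k l true h')
  have hEne : ∀ k l, E k true ≠ E l false := by
    intro k l h
    have hkl : k = l := by rw [← hc k true, ← hc l false, h]
    obtain rfl := hkl
    have hsub : (E k true : Set α) ⊆ {e (v k true)} := by
      intro a ha
      have h1 := hE k true ha
      rw [h] at ha
      have h2 := hE k false ha
      rw [← hveq k] at h2
      rcases h1 with h1 | h1
      · exact h1
      · rcases h2 with h2 | h2
        · exact h2
        · exact absurd h2 (Set.disjoint_left.1 (disjoint_side he hZ (by decide)) h1)
    exact hsing _ (E k true).2 ⟨_, (hne _ (E k true).2).subset_singleton_iff.1 hsub⟩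
  refine ⟨⟨⟨Sum.elim (fun i => E i true) (fun j => E j false), ?_⟩, ?_⟩,
    fun i => hc i true, fun j => hc j false⟩
  · rintro (i | i) (j | j) h
    · simp [completeBipartiteMinusMatching] at h
    · refine hadj' i j ?_
      rintro rfl
      simp [completeBipartiteMinusMatching] at h
    · refine (hadj' j i ?_).symm
      rintro rfl
      simp [completeBipartiteMinusMatching, Sym2.eq_swap] at h
    · simp [completeBipartiteMinusMatching] at h
  · rintro (i | i) (j | j) h
    · rw [← hc i true, ← hc j true]
      exact congrArg _ (congrArg c h)
    · exact absurd h (hEne i j)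
    · exact absurd h.symm (hEne j i)
    · rw [← hc i false, ← hc j false]
      exact congrArg _ (congrArg c h)

/-- If `KG(H)` is colored with `cd₂(H)` colors, it contains a copy of `K*_{t,t}` on both sides of
which the colors appear in the standard order. -/
theorem exists_copy_of_coloring (hfin : H.vertexSet.Finite)
    (hsing : ∀ e ∈ H.edgeSet, ¬ ∃ x, e = {x}) (hcd : H.cd2 = t)
    (c : H.kneserGraph.Coloring (Fin t)) :
    ∃ f : SimpleGraph.Copy (completeBipartiteMinusMatching t) H.kneserGraph,
      (∀ i, c (f (Sum.inl i)) = i) ∧ ∀ j, c (f (Sum.inr j)) = j := by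
  have hedge : ∀ E ∈ H.edgeSet, E.Nonempty := fun E hE =>
    nonempty_of_cd2_ne_top (by simp [hcd]) hE
  have : Finite H.vertexSet := hfin
  obtain ⟨n, ⟨g⟩⟩ := Finite.exists_equiv_fin H.vertexSet
  let e : Fin n → α := fun x => (g.symm x : α)
  have he : Function.Injective e := Subtype.val_injective.comp g.symm.injective
  have hrange : Set.range e = H.vertexSet := by
    rw [show e = Subtype.val ∘ g.symm from rfl, g.symm.surjective.range_comp, Subtype.range_coe]
  have hcard : ∀ X, IsConsistent X → signedColors c e X = ∅ → t + X.card ≤ n := by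
    intro X hX h0
    have := cd2_add_card_le (H := H) he hrange hX fun E hE b hEX => by
      have hmem : (c ⟨E, hE⟩, b) ∈ signedColors c e X := mem_signedColors.2 ⟨⟨E, hE⟩, rfl, hEX⟩
      simp [h0] at hmem
    rw [hcd] at this
    exact_mod_cast this
  -- This makes the truncated difference m = n - t satisfy m + t = n.
  have htn : t ≤ n := by
    have h0 : signedColors c e ∅ = ∅ := by
      rw [Finset.eq_empty_iff_forall_notMem]
      rintro ⟨k, b⟩ hk
      obtain ⟨E, -, hE⟩ := mem_signedColors.1 hk
      obtain ⟨a, ha⟩ := hedge E E.2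
      obtain ⟨x, hx, -⟩ := hE ha
      simp at hx
    have := hcard ∅ (fun x b b' h => by simp at h) h0
    simpa using this
  obtain ⟨Z, hZ, hZ0, hins⟩ := exists_forall_exists_insert_eq_singleton
    (f := signedColors c e) (m := n - t) (by omega) (signedColors_mono c e)
    (signedColors_isConsistent hedge c he) (signedColors_neg c e) (by
      intro X hX hm
      rw [Finset.nonempty_iff_ne_empty]
      intro h0
      have := hcard X hX h0
      omega)
  exact exists_copy_of_insert_eq_singleton hedge hsing c he hZ hZ0 hins

end Hypergraph

theorem corollary1p1 {α : Type*} (H : Hypergraph α)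
    (hfin : H.vertexSet.Finite)
    (hne : H.edgeSet.Nonempty)
    (hsing : ∀ e ∈ H.edgeSet, ¬ ∃ x, e = {x})
    (t : ℕ)
    (hchi : H.kneserGraph.chromaticNumber = t)
    (hcd : H.cd2 = t)
    (c : H.kneserGraph.Coloring (Fin t)) :
    ∃ f : SimpleGraph.Copy (completeBipartiteMinusMatching t) H.kneserGraph,
      (∀ k : Fin t, ∃ i : Fin t, c (f (Sum.inl i)) = k) ∧
      (∀ k : Fin t, ∃ j : Fin t, c (f (Sum.inr j)) = k) := by
  obtain ⟨f, hf1, hf2⟩ := Hypergraph.exists_copy_of_coloring hfin hsing hcd c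
  exact ⟨f, fun k => ⟨k, hf1 k⟩, fun k => ⟨k, hf2 k⟩⟩
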